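/- **Setting.** Let $\Sigma$ be a compact surface, possibly with boundary, embedded in a Euclidean space as one half of its double $D\Sigma=\Sigma\cup\tau\Sigma$, where $D\Sigma$ is a smooth closed embedded surface and the mirror involution $\tau$ is induced by a linear isometry and fixes exactly the points of $\partial\Sigma$. For a finite set $V$ let $\overline{\mathrm{Conf}(V,\Sigma)}$ be the Fulton–MacPherson (Axelrod–Singer) compactified configuration space, where collisions with mirror points are also recorded: the closure of the set of configurations of distinct interior points of $\Sigma$, each taken together with, for every set of at least two of the points or mirror points that involves two distinct labels, the rescaled relative positions of its members. For $K,M\subseteq V$ let $\partial_{K,M}$ be its closed stratum where the points of $K$ collide to one point and the points of $M$ hit $\partial\Sigma$ (the closure of the set where nothing else collides or hits the boundary). Let $P$ be a one-form on $\overline{\mathrm{Conf}(2,\Sigma)}$ (the propagator) such that $dP$ is the pullback of a two-form $\Xi$ on $\Sigma\times\Sigma$, and let $\varphi_\ell$ be external fields, homogeneous forms on $\Sigma$. A Feynman graph $\Gamma$ with vertex set $V$ is a finite ordered list of directed edges between vertices, each carrying $P$ or $\Xi$, and of external legs at vertices, each decorated by a field $\varphi_\ell$ or by $d\varphi_\ell$.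 A *tadpole* is an edge that starts and ends at the same vertex. The operations on graphs are: * multiplication: superposition of graphs on the same vertices, and disjoint union; * reordering of the edges and legs, and relabelling of the vertices (including the addition of vertices that are not attached to the graph); * the action of $Q$: $Q\Gamma$ is the sum, with Koszul signs, of the graphs obtained from $\Gamma$ by replacing one edge $P$ by $\Xi$, or one decoration $\varphi_\ell$ by $d\varphi_\ell$; * restriction to $\partial_{K,M}$ with $K\ne\emptyset$: it sends $\Gamma$ to the pair of the subgraph $\Gamma'$ on $K$, consisting of all edges with both ends in $K$, and the quotient graph $\Gamma/\Gamma'$, in which $K$ is merged to one vertex and which has all other edges and all legs. The amplitude $W(\Gamma)$ of a graph without tadpoles is the wedge product over its edges and legs of the pullbacks of $P$, $\Xi$, $\varphi_\ell$ and $d\varphi_\ell$ to $\overline{\mathrm{Conf}(V,\Sigma)}$ (this is the analytic integrand of the Feynman integral). For graphs with tadpoles, where $P(z,z)$ is undefined, one sets $W(\Gamma)=0$. **Proposition.** Feynman graphs with tadpoles can be set to zero consistently. That is, none of the operations creates or destroys tadpoles: a product $\Gamma_1\Gamma_2$ has a tadpole if and only if $\Gamma_1$ or $\Gamma_2$ has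 one; reordering and relabelling preserve both having and not having tadpoles; each graph occurring in $Q\Gamma$ has a tadpole if and only if $\Gamma$ has one; and $\Gamma$ has a tadpole if and only if $\Gamma'$ or $\Gamma/\Gamma'$ has one. Moreover, the amplitude $W$, extended by zero to graphs with tadpoles, is for every graph a smooth differential form of the total degree of the edges and legs, and it is compatible with all the operations, for all graphs with or without tadpoles: 1. $W(\Gamma_1\Gamma_2)=W(\Gamma_1)\wedge W(\Gamma_2)$ for graphs on the same vertices, and $W(\Gamma_1\sqcup\Gamma_2)=\pi_1^*W(\Gamma_1)\wedge\pi_2^*W(\Gamma_2)$ for graphs on different vertices, where $\pi_1,\pi_2$ are the forgetful maps. 2. Exchanging two neighbouring edges or legs of degrees $a$, $b$ multiplies $W$ by $(-1)^{ab}$; and $W(f_*\Gamma)=\pi_f^*W(\Gamma)$ for every injective map $f:V\to V'$ of finite sets with forgetful map $\pi_f:\overline{\mathrm{Conf}(V',\Sigma)}\to\overline{\mathrm{Conf}(V,\Sigma)}$. 3. $d\,W(\Gamma)=W(Q\Gamma)$. 4. On $\partial_{K,M}$, the forgetful map $p$ to $\overline{\mathrm{Conf}(K,\Sigma)}$ takes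 values in the closed stratum of $\overline{\mathrm{Conf}(K,\Sigma)}$ where all points collide (and those in $M\cap K$ hit $\partial\Sigma$); the map $q$ to $\overline{\mathrm{Conf}(V/K,\Sigma)}$ that keeps one point of $K$ does not depend on the choice of this point; and $$W(\Gamma)|_{\partial_{K,M}}=\pm\,p^*W(\Gamma')\wedge q^*W(\Gamma/\Gamma'),$$ where $\pm$ is the Koszul sign of moving the edges of $\Gamma'$ to the left. -/

import Mathlib

open scoped ContDiff

noncomputable section

namespace TadpoleFree

/-! ## Differential forms on subsets of a normed space

A form on a subset `X` of a normed space is a compatible family of ordinary forms on `ℝⁿ`, one for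
every smooth map `ℝⁿ → X` (a plot).  On a manifold with boundary and corners that is embedded in a
vector space these are the usual smooth differential forms. -/

/-- The model space `ℝⁿ`. -/
abbrev Euc (n : ℕ) : Type := EuclideanSpace ℝ (Fin n)

/-- The exterior algebra `Λ (ℝⁿ)*`; its product is the wedge product. -/
abbrev Ext (n : ℕ) : Type := ExteriorAlgebra ℝ (Module.Dual ℝ (Euc n))

/-- The coordinate basis `dx₀, …, dx_{n-1}` of `(ℝⁿ)*`. -/
def dx (n : ℕ) : Module.Basis (Fin n) ℝ (Module.Dual ℝ (Euc n)) :=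
  (EuclideanSpace.basisFun (Fin n) ℝ).toBasis.dualBasis

/-- The basis `dx_I` of `Λ (ℝⁿ)*`, indexed by the subsets `I` of the set of coordinates. -/
def dxBasis (n : ℕ) : Module.Basis (Finset (Fin n)) ℝ (Ext n) := (dx n).ExteriorAlgebra

/-- The partial derivative `∂ᵢ α` of `α : ℝⁿ → Λ (ℝⁿ)*`, taken coefficient by coefficient. -/
def partialDeriv {n : ℕ} (i : Fin n) (α : Euc n → Ext n) (a : Euc n) : Ext n :=
  ∑ I : Finset (Fin n),
    fderiv ℝ (fun y => (dxBasis n).repr (α y) I) a (EuclideanSpace.single i 1) • dxBasis n I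

/-- The exterior derivative `dα = ∑ᵢ dxᵢ ∧ ∂ᵢ α` on `ℝⁿ`. -/
def extD {n : ℕ} (α : Euc n → Ext n) (a : Euc n) : Ext n :=
  ∑ i : Fin n, ExteriorAlgebra.ι ℝ (dx n i) * partialDeriv i α a

section Spaces

variable {A B C : Type*} [NormedAddCommGroup A] [NormedSpace ℝ A]
  [NormedAddCommGroup B] [NormedSpace ℝ B] [NormedAddCommGroup C] [NormedSpace ℝ C]

/-- A smooth map between subsets of normed spaces (the restriction of a smooth map of the ambient
spaces). -/
structure SmoothMap (X : Set A) (Y : Set B) where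
  toFun : A → B
  contDiff : ContDiff ℝ ∞ toFun
  mapsTo : Set.MapsTo toFun X Y

/-- A plot of `X`: a smooth map `ℝⁿ → A` with values in `X`. -/
abbrev Plot (X : Set A) (n : ℕ) := SmoothMap (Set.univ : Set (Euc n)) X

/-- Composition of smooth maps. -/
def SmoothMap.comp {X : Set A} {Y : Set B} {Z : Set C} (g : SmoothMap Y Z) (f : SmoothMap X Y) :
    SmoothMap X Z where
  toFun := g.toFun ∘ f.toFun
  contDiff := g.contDiff.comp f.contDiff
  mapsTo := g.mapsTo.comp f.mapsTo

/-- The inclusion of a subset. -/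
def SmoothMap.incl {X Y : Set A} (h : X ⊆ Y) : SmoothMap X Y where
  toFun := id
  contDiff := contDiff_id
  mapsTo := h

/-- A family of functions `ℝⁿ → Λ (ℝⁿ)*`, one for every plot of `X`.  It is a ring, plot by plot and
point by point, under the wedge product. -/
abbrev PreForm (X : Set A) := ∀ n : ℕ, Plot X n → Euc n → Ext n

/-- A family `α` is a smooth differential form on `X` if its coefficients are smooth along every plot
and it is compatible with the pullback along smooth maps `g : ℝᵐ → ℝⁿ`. -/
structure IsForm {X : Set A} (α : PreForm X) : Prop where
  smooth : ∀ (n : ℕ) (p : Plot X n) (I : Finset (Fin n)),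
    ContDiff ℝ ∞ fun a => (dxBasis n).repr (α n p a) I
  natural : ∀ (m n : ℕ) (p : Plot X n)
    (g : SmoothMap (Set.univ : Set (Euc m)) (Set.univ : Set (Euc n))) (a : Euc m),
    α m (p.comp g) a =
      ExteriorAlgebra.map (fderiv ℝ g.toFun a).toLinearMap.dualMap (α n p (g.toFun a))

/-- The pullback of forms along a smooth map. -/
def pullback {X : Set A} {Y : Set B} (f : SmoothMap X Y) (α : PreForm Y) : PreForm X :=
  fun n p => α n (f.comp p)

/-- The de Rham differential. -/
def deRham {X : Set A} (α : PreForm X) : PreForm X := fun n p => extD (α n p)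

/-- Smooth differential `k`-forms on `X`. -/
structure Form (X : Set A) (k : ℕ) where
  val : PreForm X
  isForm : IsForm val
  degree : ∀ (n : ℕ) (p : Plot X n) (a : Euc n), val n p a ∈ ⋀[ℝ]^k (Module.Dual ℝ (Euc n))

end Spaces

/-! ## The worldsheet and the compactified configuration spaces -/

section Worldsheet

variable {E : Type*} [NormedAddCommGroup E] [InnerProductSpace ℝ E]

/-- `D` is an embedded smooth surface without boundary: near each of its points there are a smooth
parametrization `g` by an open subset of `ℝ²` and a smooth left inverse `r` of `g`. -/
def IsEmbeddedSurface (D : Set E) : Prop :=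
  ∀ x ∈ D, ∃ (U : Set E) (W : Set (Euc 2)) (g : Euc 2 → E) (r : E → Euc 2),
    IsOpen U ∧ x ∈ U ∧ IsOpen W ∧ ContDiffOn ℝ ∞ g W ∧ ContDiffOn ℝ ∞ r U ∧
    Set.MapsTo g W (D ∩ U) ∧ Set.MapsTo r (D ∩ U) W ∧
    (∀ a ∈ W, r (g a) = a) ∧ ∀ y ∈ D ∩ U, g (r y) = y

variable (E) in
/-- A compact surface `Σ`, possibly with boundary, embedded in a Euclidean space as one half of its
double `DΣ = Σ ∪ τΣ`.  The involution `τ` of `DΣ` (the mirror) is induced by a linear isometry and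
fixes exactly the points of `∂Σ`; in particular `∂Σ` is geodesic. -/
structure Worldsheet where
  carrier : Set E
  mirror : E ≃ₗᵢ[ℝ] E
  mirror_mirror : ∀ x, mirror (mirror x) = x
  isCompact : IsCompact carrier
  isSurface_double : IsEmbeddedSurface (carrier ∪ mirror '' carrier)
  fixed_of_mem_inter : ∀ x ∈ carrier, mirror x ∈ carrier → mirror x = x
  interior_dense : carrier ⊆ closure {x ∈ carrier | mirror x ≠ x}

/-- The screen of the points `yᵢ`, `i ∈ T`: the configuration translated to have barycentre `0` and
rescaled to have norm `1`.  It records how these points collide in the limit. -/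
def screen {ι : Type*} [DecidableEq ι] (T : Finset ι) (y : ι → E) (i : ι) : E :=
  if i ∈ T then
    (Real.sqrt (∑ j ∈ T, ‖y j - (T.card : ℝ)⁻¹ • ∑ l ∈ T, y l‖ ^ 2))⁻¹ •
      (y i - (T.card : ℝ)⁻¹ • ∑ l ∈ T, y l)
  else 0

/-- The vertex below a vertex or a mirror vertex. -/
abbrev under {V : Type*} : V ⊕ V → V := Sum.elim id id

/-- `T` involves at least two distinct vertices. -/
def Separates {V : Type*} (T : Finset (V ⊕ V)) : Prop :=
  ∃ i ∈ T, ∃ j ∈ T, under i ≠ under j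

/-- The ambient vector space of the compactified configuration space: positions of the points,
and one screen for every set `T` of vertices and mirror vertices. -/
abbrev Ambient (V E : Type*) := (V → E) × (Finset (V ⊕ V) → V ⊕ V → E)

namespace Worldsheet

variable (S : Worldsheet E) {V V' : Type} [Fintype V] [DecidableEq V] [Fintype V'] [DecidableEq V']

/-- The points `xᵥ` together with their mirror images. -/
def doubled {V : Type} (x : V → E) : V ⊕ V → E := Sum.elim x (S.mirror ∘ x)

open Classical in
/-- A configuration of points with all its screens.  (The pairs consisting of a point and its own
mirror image are not recorded.) -/
def withScreens (x : V → E) : Ambient V E :=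
  (x, fun T => if Separates T then screen T (S.doubled x) else 0)

variable (V) in
/-- `Conf(V, Σ°)`: pairwise distinct points in the interior of `Σ`, labelled by `V`. -/
def openConf : Set (V → E) :=
  {x | Function.Injective x ∧ ∀ v, x v ∈ S.carrier ∧ S.mirror (x v) ≠ x v}

variable (V) in
/-- The compactified configuration space `\overline{Conf(V, Σ)}` of Fulton–MacPherson and
Axelrod–Singer, with mirror points as in Kontsevich's version for surfaces with boundary: the closure
of the space of configurations with their screens. -/
def conf : Set (Ambient V E) := closure (S.withScreens '' S.openConf V)

/-- The linear map that keeps the positions and the screens of the points labelled by `V` among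
those labelled by `V'`. -/
def forgetFun (f : V ↪ V') (c : Ambient V' E) : Ambient V E :=
  (fun v => c.1 (f v), fun T i => c.2 (T.map (f.sumMap f)) (f.sumMap f i))

theorem contDiff_forgetFun {V V' : Type} [Fintype V] [Fintype V'] (f : V ↪ V') :
    ContDiff ℝ ∞ (forgetFun (E := E) f) := by
  unfold forgetFun
  fun_prop

theorem separates_map {V V' : Type} (f : V ↪ V') (T : Finset (V ⊕ V)) :
    Separates (T.map (f.sumMap f)) ↔ Separates T := by
  have h : ∀ i : V ⊕ V, under (f.sumMap f i) = f (under i) := by rintro (i | i) <;> rfl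
  simp only [Separates, Finset.mem_map, exists_exists_and_eq_and, h, ne_eq,
    f.injective.eq_iff]

theorem screen_map {ι ι' : Type*} [DecidableEq ι] [DecidableEq ι'] (f : ι ↪ ι') (T : Finset ι)
    (y : ι' → E) (i : ι) : screen (T.map f) y (f i) = screen T (y ∘ f) i := by
  simp [screen]

theorem forgetFun_withScreens {V V' : Type} [DecidableEq V] [DecidableEq V'] (f : V ↪ V') (x : V' → E) :
    forgetFun f (S.withScreens x) = S.withScreens (x ∘ f) := by
  have h : S.doubled x ∘ f.sumMap f = S.doubled (x ∘ f) := by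
    funext i; rcases i with i | i <;> rfl
  refine Prod.ext rfl ?_
  funext T i
  by_cases hT : Separates T
  · simp only [forgetFun, withScreens, separates_map, hT, screen_map, h, if_true]
  · simp [forgetFun, withScreens, separates_map, hT]

/-- The forgetful map `\overline{Conf(V', Σ)} → \overline{Conf(V, Σ)}` along `V ↪ V'`. -/
def forget (f : V ↪ V') : SmoothMap (S.conf V') (S.conf V) where
  toFun := forgetFun f
  contDiff := contDiff_forgetFun f
  mapsTo := by
    refine Set.MapsTo.closure ?_ (contDiff_forgetFun f).continuous
    rintro _ ⟨x, hx, rfl⟩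
    rw [forgetFun_withScreens]
    exact ⟨x ∘ f, ⟨hx.1.comp f.injective, fun v => hx.2 (f v)⟩, rfl⟩

theorem fst_mem {V : Type} [DecidableEq V] (c : Ambient V E) (hc : c ∈ S.conf V) (v : V) : c.1 v ∈ S.carrier := by
  have hcl : IsClosed {c : Ambient V E | c.1 v ∈ S.carrier} :=
    S.isCompact.isClosed.preimage (by fun_prop)
  refine closure_minimal ?_ hcl hc
  rintro _ ⟨x, hx, rfl⟩
  exact (hx.2 v).1

/-- The position of the point `v`. -/
def position (v : V) : SmoothMap (S.conf V) S.carrier where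
  toFun c := c.1 v
  contDiff := by fun_prop
  mapsTo c hc := S.fst_mem c hc v

/-- The blow-down map onto `Σ × Σ` given by the positions of the points `v` and `w`. -/
def positions (v w : V) : SmoothMap (S.conf V) (S.carrier ×ˢ S.carrier) where
  toFun c := (c.1 v, c.1 w)
  contDiff := by fun_prop
  mapsTo c hc := ⟨S.fst_mem c hc v, S.fst_mem c hc w⟩

/-- The closed stratum `∂_{K,M}` of the compactified configuration space: the closure of the set of
the points where the points in `K` have collided to a single point, no other points have collided, and
exactly the points in `M` have hit the boundary of `Σ`. -/
def stratum (K M : Finset V) : Set (Ambient V E) :=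
  closure {c ∈ S.conf V | (∀ v w, c.1 v = c.1 w ↔ v = w ∨ (v ∈ K ∧ w ∈ K)) ∧
    ∀ v, S.mirror (c.1 v) = c.1 v ↔ v ∈ M}

theorem stratum_subset {V : Type} [DecidableEq V] (K M : Finset V) : S.stratum K M ⊆ S.conf V :=
  closure_minimal (fun _ hc => hc.1) isClosed_closure

/-- The inclusion of a closed stratum. -/
def stratumIncl (K M : Finset V) : SmoothMap (S.stratum K M) (S.conf V) :=
  .incl (S.stratum_subset K M)

end Worldsheet

end Worldsheet

/-! ## Feynman graphs -/

section Graphs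

variable {V V' L : Type*}

/-- The constituents of a Feynman graph with vertex set `V` and external fields labelled by `L`:
directed edges carrying the propagator `P`; directed edges carrying the diagonal class `Ξ`; and
external legs at a vertex, decorated by an external field `φ ℓ` or by `dφ ℓ`. -/
inductive Part (V L : Type*) where
  | propagator (v w : V) : Part V L
  | diagonal (v w : V) : Part V L
  | leg (v : V) (ℓ : L) : Part V L
  | dleg (v : V) (ℓ : L) : Part V L

/-- A Feynman graph with vertex set `V`, given by its edges and legs in some order.  (The order is the
orientation datum: it fixes the sign of the amplitude.) -/
abbrev FeynmanGraph (V L : Type*) := List (Part V L)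

/-- Formal linear combinations of Feynman graphs. -/
abbrev GraphSpace (V L : Type*) := FeynmanGraph V L →₀ ℝ

namespace Part

/-- The edges that start and end at the same vertex. -/
def IsLoop : Part V L → Prop
  | propagator v w => v = w
  | diagonal v w => v = w
  | leg _ _ => False
  | dleg _ _ => False

/-- The degree of the differential form carried by an edge or a leg, where `deg ℓ` is the form degree
of the external field `φ ℓ`. -/
def degree (deg : L → ℕ) : Part V L → ℕ
  | propagator _ _ => 1
  | diagonal _ _ => 2
  | leg _ ℓ => deg ℓ
  | dleg _ ℓ => deg ℓ + 1

/-- The action of `Q`: it turns a propagator into a diagonal class and an external field `φ` into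
`dφ`, and kills the rest. -/
def applyQ : Part V L → Option (Part V L)
  | propagator v w => some (diagonal v w)
  | diagonal _ _ => none
  | leg v ℓ => some (dleg v ℓ)
  | dleg _ _ => none

/-- Relabelling of the vertices. -/
def relabel (f : V → V') : Part V L → Part V' L
  | propagator v w => propagator (f v) (f w)
  | diagonal v w => diagonal (f v) (f w)
  | leg v ℓ => leg (f v) ℓ
  | dleg v ℓ => dleg (f v) ℓ

/-- An edge with both ends in `K`, seen as an edge between vertices in `K`. -/
def inside [DecidableEq V] (K : Finset V) : Part V L → Option (Part {v // v ∈ K} L)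
  | propagator v w => if h : v ∈ K ∧ w ∈ K then some (propagator ⟨v, h.1⟩ ⟨w, h.2⟩) else none
  | diagonal v w => if h : v ∈ K ∧ w ∈ K then some (diagonal ⟨v, h.1⟩ ⟨w, h.2⟩) else none
  | leg _ _ => none
  | dleg _ _ => none

end Part

/-- The vertex set obtained from `V` by merging the vertices in `K` into one new vertex `none`. -/
abbrev MergedVertices (V : Type*) (K : Finset V) := Option {v : V // v ∉ K}

/-- The projection of `V` to the vertex set with `K` merged. -/
def collapse [DecidableEq V] (K : Finset V) (v : V) : MergedVertices V K :=
  if h : v ∈ K then none else some ⟨v, h⟩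

/-- The section of `collapse K` that represents the merged vertex by `s ∈ K`. -/
def represent (K : Finset V) (s : V) (hs : s ∈ K) : MergedVertices V K ↪ V where
  toFun o := o.elim s Subtype.val
  inj' := by
    rintro (_ | ⟨v, hv⟩) (_ | ⟨w, hw⟩) h
    · rfl
    · exact absurd ((show s = w from h) ▸ hs) hw
    · exact absurd ((show v = s from h) ▸ hs) hv
    · exact congrArg some (Subtype.ext h)

namespace FeynmanGraph

/-- A graph has a tadpole if one of its edges starts and ends at the same vertex. -/
def HasTadpole (Γ : FeynmanGraph V L) : Prop := ∃ e ∈ Γ, e.IsLoop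

/-- The total form degree. -/
def degree (deg : L → ℕ) (Γ : FeynmanGraph V L) : ℕ := (Γ.map (Part.degree deg)).sum

/-- Relabelling of the vertices of a graph. -/
def relabel (f : V → V') (Γ : FeynmanGraph V L) : FeynmanGraph V' L := Γ.map (Part.relabel f)

/-- The product of two graphs with vertex sets `V` and `V'`: their disjoint union. -/
def disjointUnion (Γ : FeynmanGraph V L) (Γ' : FeynmanGraph V' L) : FeynmanGraph (V ⊕ V') L :=
  relabel Sum.inl Γ ++ relabel Sum.inr Γ'

/-- The action of `Q` on graphs: the signed sum over all propagators replaced by a diagonal class and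
all external fields replaced by their differential (a graded derivation). -/
def applyQ (deg : L → ℕ) : FeynmanGraph V L → GraphSpace V L
  | [] => 0
  | e :: Γ =>
    (match e.applyQ with
      | some e' => Finsupp.single (e' :: Γ) 1
      | none => 0) +
    (-1 : ℝ) ^ e.degree deg • (applyQ deg Γ).mapDomain (e :: ·)

/-- The cut of a graph `Γ` along a set `K` of vertices: a sign, the subgraph `Γ'` of all the edges
with both ends in `K`, and the quotient graph `Γ/Γ'` in which `K` is merged to one vertex; it carries
all other edges and all the legs.  The sign is the one of moving the edges of `Γ'` to the left. -/
def cut [DecidableEq V] (deg : L → ℕ) (K : Finset V) :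
    FeynmanGraph V L → ℝ × FeynmanGraph {v // v ∈ K} L × FeynmanGraph (MergedVertices V K) L
  | [] => (1, [], [])
  | e :: Γ =>
    let r := cut deg K Γ
    match e.inside K with
    | some e' => (r.1, e' :: r.2.1, r.2.2)
    | none => ((-1) ^ (e.degree deg * degree deg r.2.1) * r.1, r.2.1,
        e.relabel (collapse K) :: r.2.2)

end FeynmanGraph

end Graphs

/-! ## Feynman rules -/

section FeynmanRules

variable {E : Type*} [NormedAddCommGroup E] [InnerProductSpace ℝ E]

/-- The embedding of the two-point set as the pair of distinct points `v`, `w`. -/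
def pairEmb {V : Type} (v w : V) (h : v ≠ w) : Fin 2 ↪ V where
  toFun := ![v, w]
  inj' := by
    intro i j hij
    fin_cases i <;> fin_cases j <;> simp_all [eq_comm]

/-- The analytic input of the Feynman rules on the worldsheet `S`: a propagator, i.e. a one-form `P`
on the compactified configuration space of two points whose differential descends to the two-form
`Ξ` on `Σ × Σ`, and the external fields `φ ℓ`, forms on `Σ` of degree `deg ℓ`. -/
structure FeynmanData (S : Worldsheet E) (L : Type*) where
  P : Form (S.conf (Fin 2)) 1
  Ξ : Form (S.carrier ×ˢ S.carrier) 2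
  deRham_P : deRham P.val = pullback (S.positions 0 1) Ξ.val
  deg : L → ℕ
  φ : ∀ ℓ : L, Form S.carrier (deg ℓ)

namespace FeynmanData

variable {S : Worldsheet E} {L : Type*} (D : FeynmanData S L)
  {V : Type} [Fintype V] [DecidableEq V]

/-- The form on the configuration space of the vertices that is carried by an edge or a leg.  The value
`P(z, z)` of the propagator is not defined; the entry `0` there is never used. -/
def partForm : Part V L → PreForm (S.conf V)
  | .propagator v w => if h : v ≠ w then pullback (S.forget (pairEmb v w h)) D.P.val else 0
  | .diagonal v w => pullback (S.positions v w) D.Ξ.val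
  | .leg v ℓ => pullback (S.position v) (D.φ ℓ).val
  | .dleg v ℓ => pullback (S.position v) (deRham (D.φ ℓ).val)

open Classical in
/-- The analytic amplitude (Feynman integrand) of a graph on the configuration space of its vertices,
where graphs with tadpoles are set to zero. -/
def amplitude (Γ : FeynmanGraph V L) : PreForm (S.conf V) :=
  if Γ.HasTadpole then 0 else (Γ.map D.partForm).prod

/-- The linear extension of the amplitude to formal sums of graphs. -/
def amplitudeSum (x : GraphSpace V L) : PreForm (S.conf V) :=
  x.sum fun Γ c => c • D.amplitude Γ

end FeynmanData

end FeynmanRules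

end TadpoleFree

end

namespace TadpoleFree

/-! ## Calculus of functions with values in the exterior algebra -/

/-! Being a loop is a property of a single edge, and each operation either keeps the ends of an edge
or relabels them injectively. The one exception is the quotient by `K`, where an edge becomes a loop
exactly when its ends agree or both lie in `K`. Edges of the second kind have already been moved to
the subgraph, so no tadpole appears in the quotient (`Part.isLoop_relabel_collapse`,
`hasTadpole_cut`). Hence in every identity, if a tadpole is present, both sides vanish.

For the remaining graphs the amplitude is a product over edges and legs, so each identity reduces to
one about single factors, together with a sign from graded commutativity or from the Leibniz rule.
This needs the usual calculus of forms: `extD_mul`, `extD_extD` and naturality `extD_pullAt`. The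
differential of a propagator is the pullback of `Ξ` by assumption, and this also makes `Ξ` closed
once it is pulled back to two distinct labels (`deRham_partForm`).

The geometric content is in `forgetFun_eq_of_mem_stratum`. A propagator that is not inside `K` joins
two points that stay apart on the open stratum. Their screens are then functions of the positions,
so the ends in `K` may be replaced by any representative. Continuity extends this to the closed
stratum. -/

/-- The sup norm on `Λ (ℝⁿ)*` with respect to the coordinate basis. -/
noncomputable instance extNormedAddCommGroup (n : ℕ) : NormedAddCommGroup (Ext n) :=
  NormedAddCommGroup.induced _ _ (dxBasis n).equivFun.toLinearMap (dxBasis n).equivFun.injective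

noncomputable instance extNormedSpace (n : ℕ) : NormedSpace ℝ (Ext n) :=
  NormedSpace.induced _ _ _ (dxBasis n).equivFun.toLinearMap

instance extFiniteDimensional (n : ℕ) : FiniteDimensional ℝ (Ext n) :=
  Module.Basis.finiteDimensional_of_finite (dxBasis n)

/-- The definitions of forms and of `extD` are coefficientwise. This lemma and `partialDeriv_eq`
translate them to calculus in the normed space `Ext n`. -/
theorem contDiff_iff_coeff {n m : ℕ} (α : Euc m → Ext n) :
    ContDiff ℝ ∞ α ↔ ∀ I, ContDiff ℝ ∞ fun a => (dxBasis n).repr (α a) I := by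
  have h := (dxBasis n).equivFun.toContinuousLinearEquiv.comp_contDiff_iff (f := α) (n := ∞)
  rw [← h, contDiff_pi]
  rfl

theorem partialDeriv_eq {n : ℕ} (i : Fin n) {α : Euc n → Ext n} {a : Euc n}
    (h : DifferentiableAt ℝ α a) :
    partialDeriv i α a = fderiv ℝ α a (EuclideanSpace.single i 1) := by
  rw [partialDeriv, ← (dxBasis n).sum_repr (fderiv ℝ α a (EuclideanSpace.single i 1))]
  refine Finset.sum_congr rfl fun I _ => ?_
  congr 1
  have := ((dxBasis n).coord I).toContinuousLinearMap.hasFDerivAt.comp a h.hasFDerivAt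
  exact DFunLike.congr_fun this.fderiv _

theorem extD_eq {n : ℕ} {α : Euc n → Ext n} {a : Euc n} (h : DifferentiableAt ℝ α a) :
    extD α a = ∑ i, ExteriorAlgebra.ι ℝ (dx n i) * fderiv ℝ α a (EuclideanSpace.single i 1) := by
  simp only [extD, partialDeriv_eq _ h]

theorem contDiff_ext_mul {n m : ℕ} {α β : Euc m → Ext n} (hα : ContDiff ℝ ∞ α)
    (hβ : ContDiff ℝ ∞ β) : ContDiff ℝ ∞ fun a => α a * β a :=
  (((LinearMap.mul ℝ (Ext n)).toContinuousBilinearMap).isBoundedBilinearMap.contDiff).comp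
    (hα.prodMk hβ)

theorem fderiv_ext_mul {n m : ℕ} {α β : Euc m → Ext n} {a : Euc m} (hα : DifferentiableAt ℝ α a)
    (hβ : DifferentiableAt ℝ β a) (v : Euc m) :
    fderiv ℝ (fun a => α a * β a) a v = fderiv ℝ α a v * β a + α a * fderiv ℝ β a v := by
  have := ((LinearMap.mul ℝ (Ext n)).toContinuousBilinearMap).hasFDerivAt_of_bilinear
    hα.hasFDerivAt hβ.hasFDerivAt
  refine (DFunLike.congr_fun this.fderiv v).trans ?_
  simp [add_comm]

theorem fderiv_linear {n m k : ℕ} (T : Ext n →ₗ[ℝ] Ext k) {α : Euc m → Ext n} {a : Euc m}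
    (hα : DifferentiableAt ℝ α a) (v : Euc m) :
    fderiv ℝ (fun a => T (α a)) a v = T (fderiv ℝ α a v) :=
  DFunLike.congr_fun (T.toContinuousLinearMap.hasFDerivAt.comp a hα.hasFDerivAt).fderiv v

theorem dual_eq_sum_dx {n : ℕ} (ℓ : Module.Dual ℝ (Euc n)) :
    ℓ = ∑ i, ℓ (EuclideanSpace.single i 1) • dx n i := by
  conv_lhs => rw [← (EuclideanSpace.basisFun (Fin n) ℝ).toBasis.sum_dual_apply_smul_coord ℓ]
  simp [dx, Module.Basis.coe_dualBasis]

/-- Reassembles a differential from its partial derivatives; applied to the derivative of a function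
in `extD_algebraMap`. -/
theorem sum_ι_dx_mul {n : ℕ} (ℓ : Module.Dual ℝ (Euc n)) (x : Ext n) :
    ∑ i, ExteriorAlgebra.ι ℝ (dx n i) * (ℓ (EuclideanSpace.single i 1) • x) =
      ExteriorAlgebra.ι ℝ ℓ * x := by
  conv_rhs => rw [dual_eq_sum_dx ℓ]
  simp [Finset.sum_mul]

/-! ### The grade involution and graded commutativity -/

section Graded

variable {M : Type*} [AddCommGroup M] [Module ℝ M]

/-- The involution is an algebra map, so the claim passes to products and only generators matter,
where it is anticommutativity. It is the source of all Koszul signs below. -/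
theorem ι_mul_eq_involute_mul_ι (v : M) (x : ExteriorAlgebra ℝ M) :
    ExteriorAlgebra.ι ℝ v * x = CliffordAlgebra.involute x * ExteriorAlgebra.ι ℝ v := by
  induction x using ExteriorAlgebra.induction with
  | algebraMap r => rw [AlgHom.commutes, Algebra.commutes]
  | ι w =>
    have h : CliffordAlgebra.involute (ExteriorAlgebra.ι ℝ w) = -ExteriorAlgebra.ι ℝ w :=
      CliffordAlgebra.involute_ι _
    rw [h, neg_mul, eq_neg_iff_add_eq_zero]
    exact ExteriorAlgebra.ι_add_mul_swap v w
  | mul a b ha hb => rw [← mul_assoc, ha, mul_assoc, hb, map_mul, mul_assoc]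
  | add a b ha hb => rw [mul_add, ha, hb, map_add, add_mul]

theorem involute_of_mem {k : ℕ} {x : ExteriorAlgebra ℝ M} (hx : x ∈ ⋀[ℝ]^k M) :
    CliffordAlgebra.involute x = (-1 : ℝ) ^ k • x := by
  induction hx using Submodule.pow_induction_on_left' with
  | algebraMap r => simp
  | add x y i _ _ hx hy => rw [map_add, hx, hy, smul_add]
  | mem_mul m hm i x _ hx =>
    obtain ⟨v, rfl⟩ := hm
    have h : CliffordAlgebra.involute (ExteriorAlgebra.ι ℝ v) = -ExteriorAlgebra.ι ℝ v :=
      CliffordAlgebra.involute_ι _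
    rw [map_mul, h, hx, Nat.succ_eq_add_one, pow_succ]
    simp

/-- By induction on the degree of `x`: each covector factor of `x` passes `y` at the cost of the
involution, which is `(-1) ^ k` on `y`. -/
theorem mul_comm_of_mem {j k : ℕ} {x y : ExteriorAlgebra ℝ M} (hx : x ∈ ⋀[ℝ]^j M)
    (hy : y ∈ ⋀[ℝ]^k M) : x * y = (-1 : ℝ) ^ (j * k) • (y * x) := by
  induction hx using Submodule.pow_induction_on_left' with
  | algebraMap r => simp [Algebra.commutes]
  | add x y i _ _ hx hy => rw [add_mul, hx, hy, ← smul_add, mul_add]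
  | mem_mul m hm i x _ hx =>
    obtain ⟨v, rfl⟩ := hm
    rw [mul_assoc, hx, mul_smul_comm, ← mul_assoc, ι_mul_eq_involute_mul_ι, involute_of_mem hy,
      smul_mul_assoc, smul_mul_assoc, smul_smul, ← pow_add, mul_assoc, Nat.succ_mul]

end Graded

/-! ### The exterior derivative -/

theorem extD_zero {n : ℕ} (a : Euc n) : extD (fun _ => (0 : Ext n)) a = 0 := by
  simp [extD, partialDeriv]

theorem extD_const {n : ℕ} (c : Ext n) (a : Euc n) : extD (fun _ => c) a = 0 := by
  simp [extD, partialDeriv]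

theorem extD_add {n : ℕ} {α β : Euc n → Ext n} (hα : ContDiff ℝ ∞ α) (hβ : ContDiff ℝ ∞ β)
    (a : Euc n) : extD (fun b => α b + β b) a = extD α a + extD β a := by
  have h₁ := (hα.differentiable (by simp)).differentiableAt (x := a)
  have h₂ := (hβ.differentiable (by simp)).differentiableAt (x := a)
  rw [extD_eq (h₁.fun_add h₂), extD_eq h₁, extD_eq h₂, fderiv_fun_add h₁ h₂]
  simp [mul_add, Finset.sum_add_distrib]

/-- The sign comes from moving `dxᵢ` past `α a`. Writing it as an involution avoids any homogeneity
assumption. -/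
theorem extD_mul {n : ℕ} {α β : Euc n → Ext n} (hα : ContDiff ℝ ∞ α) (hβ : ContDiff ℝ ∞ β)
    (a : Euc n) : extD (fun b => α b * β b) a =
      extD α a * β a + CliffordAlgebra.involute (α a) * extD β a := by
  have h₁ := (hα.differentiable (by simp)).differentiableAt (x := a)
  have h₂ := (hβ.differentiable (by simp)).differentiableAt (x := a)
  have h := ((contDiff_ext_mul hα hβ).differentiable (by simp)).differentiableAt (x := a)
  rw [extD_eq h, extD_eq h₁, extD_eq h₂, Finset.sum_mul, Finset.mul_sum,
    ← Finset.sum_add_distrib]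
  refine Finset.sum_congr rfl fun i _ => ?_
  rw [fderiv_ext_mul h₁ h₂, mul_add, ← mul_assoc, ← mul_assoc, ← mul_assoc,
    ι_mul_eq_involute_mul_ι _ (α a)]

theorem contDiff_extD {n : ℕ} {α : Euc n → Ext n} (hα : ContDiff ℝ ∞ α) :
    ContDiff ℝ ∞ (extD α) := by
  have h : extD α = fun a => ∑ i, ExteriorAlgebra.ι ℝ (dx n i) *
      fderiv ℝ α a (EuclideanSpace.single i 1) :=
    funext fun a => extD_eq ((hα.differentiable (by simp)).differentiableAt)
  rw [h]
  exact ContDiff.sum fun i _ => contDiff_ext_mul contDiff_const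
    ((hα.fderiv_right (m := ∞) (by simp)).clm_apply contDiff_const)

theorem extD_extD {n : ℕ} {α : Euc n → Ext n} (hα : ContDiff ℝ ∞ α) (a : Euc n) :
    extD (extD α) a = 0 := by
  have hd : Differentiable ℝ α := hα.differentiable (by simp)
  have hf : ContDiff ℝ ∞ (fderiv ℝ α) := hα.fderiv_right (m := ∞) (by simp)
  have hfd : DifferentiableAt ℝ (fderiv ℝ α) a := (hf.differentiable (by simp)) a
  let s : Fin n → Fin n → Ext n := fun i j =>
    fderiv ℝ (fderiv ℝ α) a (EuclideanSpace.single i 1) (EuclideanSpace.single j 1)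
  have hs : ∀ i j, s i j = s j i := fun i j =>
    (hα.contDiffAt.isSymmSndFDerivAt (x := a)
      (by simpa using WithTop.coe_le_coe.2 (le_top : (2 : ℕ∞) ≤ ⊤))) _ _
  have key : ∀ i, fderiv ℝ (extD α) a (EuclideanSpace.single i 1) =
      ∑ j, ExteriorAlgebra.ι ℝ (dx n j) * s i j := by
    intro i
    have h : extD α = fun a => ∑ j, LinearMap.mulLeft ℝ (ExteriorAlgebra.ι ℝ (dx n j))
        (fderiv ℝ α a (EuclideanSpace.single j 1)) :=
      funext fun a => extD_eq (hd a)
    have hj : ∀ j, DifferentiableAt ℝ (fun b => fderiv ℝ α b (EuclideanSpace.single j 1)) a :=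
      fun j => hfd.clm_apply (differentiableAt_const _)
    have hT : ∀ j, DifferentiableAt ℝ (fun b => LinearMap.mulLeft ℝ
        (ExteriorAlgebra.ι ℝ (dx n j)) (fderiv ℝ α b (EuclideanSpace.single j 1))) a := fun j =>
      (LinearMap.mulLeft ℝ (ExteriorAlgebra.ι ℝ (dx n j))).toContinuousLinearMap.differentiableAt.comp
        a (hj j)
    rw [h, fderiv_fun_sum fun j _ => hT j, sum_apply]
    refine Finset.sum_congr rfl fun j _ => ?_
    rw [fderiv_linear _ (hj j), fderiv_clm_apply hfd (differentiableAt_const _)]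
    simp [s]
  rw [extD_eq (((contDiff_extD hα).differentiable (by simp)) a)]
  simp only [key, Finset.mul_sum]
  -- The second derivatives are symmetric in `i`, `j` while `dxᵢ ∧ dxⱼ` is antisymmetric, so
  -- exchanging the indices shows `t = -t`.
  set t := ∑ i, ∑ j, ExteriorAlgebra.ι ℝ (dx n i) * (ExteriorAlgebra.ι ℝ (dx n j) * s i j)
    with ht
  have h : t = -t := by
    conv_lhs => rw [ht, Finset.sum_comm]
    rw [ht, ← Finset.sum_neg_distrib]
    refine Finset.sum_congr rfl fun i _ => ?_
    rw [← Finset.sum_neg_distrib]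
    refine Finset.sum_congr rfl fun j _ => ?_
    rw [← mul_assoc, ← mul_assoc, eq_neg_of_add_eq_zero_left
      (ExteriorAlgebra.ι_add_mul_swap (dx n j) (dx n i)), hs, neg_mul]
  have h₂ : (2 : ℝ) • t = 0 := by
    rw [two_smul]
    nth_rewrite 1 [h]
    exact neg_add_cancel t
  exact (smul_eq_zero.1 h₂).resolve_left two_ne_zero

theorem extD_algebraMap {n : ℕ} {f : Euc n → ℝ} (hf : ContDiff ℝ ∞ f) (a : Euc n) :
    extD (fun b => algebraMap ℝ (Ext n) (f b)) a = ExteriorAlgebra.ι ℝ (fderiv ℝ f a).toLinearMap := by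
  have hd : DifferentiableAt ℝ f a := (hf.differentiable (by simp)) a
  have h := (Algebra.linearMap ℝ (Ext n)).toContinuousLinearMap.hasFDerivAt.comp a hd.hasFDerivAt
  have h' : HasFDerivAt (fun b => algebraMap ℝ (Ext n) (f b)) _ a := h
  rw [extD_eq h'.differentiableAt, h'.fderiv]
  conv_rhs => rw [← mul_one (ExteriorAlgebra.ι ℝ _), ← sum_ι_dx_mul]
  simp [Algebra.algebraMap_eq_smul_one]

theorem contDiff_algebraMap {n : ℕ} {f : Euc n → ℝ} (hf : ContDiff ℝ ∞ f) :
    ContDiff ℝ ∞ fun b => algebraMap ℝ (Ext n) (f b) :=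
  (Algebra.linearMap ℝ (Ext n)).toContinuousLinearMap.contDiff.comp hf

/-- A linear projection onto `N` fixes `α`, and it commutes with the derivative. -/
theorem fderiv_mem_submodule {n m : ℕ} (N : Submodule ℝ (Ext n)) {α : Euc m → Ext n} {a : Euc m}
    (hd : DifferentiableAt ℝ α a) (hα : ∀ b, α b ∈ N) (v : Euc m) : fderiv ℝ α a v ∈ N := by
  obtain ⟨T, hT⟩ := N.subtype.exists_leftInverse_of_injective N.ker_subtype
  have h : α = fun b => (N.subtype.comp T) (α b) :=
    funext fun b => (congrArg Subtype.val (LinearMap.congr_fun hT ⟨α b, hα b⟩)).symm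
  rw [h, fderiv_linear _ hd]
  exact (T _).2

theorem extD_mem {n k : ℕ} {α : Euc n → Ext n} (hα : ContDiff ℝ ∞ α)
    (h : ∀ a, α a ∈ ⋀[ℝ]^k (Module.Dual ℝ (Euc n))) (a : Euc n) :
    extD α a ∈ ⋀[ℝ]^(k + 1) (Module.Dual ℝ (Euc n)) := by
  have hd : DifferentiableAt ℝ α a := (hα.differentiable (by simp)) a
  rw [extD_eq hd]
  refine Submodule.sum_mem _ fun i _ => ?_
  change _ ∈ LinearMap.range (ExteriorAlgebra.ι ℝ) ^ (k + 1)
  rw [pow_succ']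
  exact Submodule.mul_mem_mul ⟨_, rfl⟩ (fderiv_mem_submodule _ hd h _)

/-! ### Naturality of the exterior derivative -/

/-- The pullback `Λ (ℝⁿ)* → Λ (ℝᵐ)*` along the derivative of `g` at `a`. -/
noncomputable abbrev pullAt {m n : ℕ} (g : Euc m → Euc n) (a : Euc m) : Ext n →ₐ[ℝ] Ext m :=
  ExteriorAlgebra.map (fderiv ℝ g a).toLinearMap.dualMap

theorem fderiv_dual_comp {m n : ℕ} {g : Euc m → Euc n} (hg : ContDiff ℝ ∞ g)
    (v : Module.Dual ℝ (Euc n)) (a : Euc m) :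
    (fderiv ℝ (fun b => v (g b)) a).toLinearMap = (fderiv ℝ g a).toLinearMap.dualMap v := by
  have h := (v.toContinuousLinearMap.hasFDerivAt.comp a
    ((hg.differentiable (by simp)) a).hasFDerivAt).fderiv
  ext x
  exact DFunLike.congr_fun h x

/-- The pullback of a constant form is smooth and closed. -/
theorem pullAt_const {m n : ℕ} {g : Euc m → Euc n} (hg : ContDiff ℝ ∞ g) (c : Ext n) :
    ContDiff ℝ ∞ (fun b => pullAt g b c) ∧ ∀ a, extD (fun b => pullAt g b c) a = 0 := by
  induction c using ExteriorAlgebra.induction with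
  | algebraMap r => simpa only [AlgHom.commutes] using ⟨contDiff_const, extD_const _⟩
  | ι v =>
    have hv : ContDiff ℝ ∞ fun b => v (g b) := v.toContinuousLinearMap.contDiff.comp hg
    -- The pullback of a constant covector `v` is the differential of the function `v ∘ g`, hence
    -- closed because `d² = 0`.
    have h : (fun b => pullAt g b (ExteriorAlgebra.ι ℝ v)) =
        extD fun b => algebraMap ℝ (Ext m) (v (g b)) := by
      funext b
      rw [extD_algebraMap hv, fderiv_dual_comp hg, ExteriorAlgebra.map_apply_ι]
    rw [h]
    exact ⟨contDiff_extD (contDiff_algebraMap hv), extD_extD (contDiff_algebraMap hv)⟩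
  | mul x y hx hy =>
    simp only [map_mul]
    refine ⟨contDiff_ext_mul hx.1 hy.1, fun a => ?_⟩
    rw [extD_mul hx.1 hy.1, hx.2, hy.2, zero_mul, mul_zero, add_zero]
  | add x y hx hy =>
    simp only [map_add]
    refine ⟨hx.1.add hy.1, fun a => ?_⟩
    rw [extD_add hx.1 hy.1, hx.2, hy.2, add_zero]

theorem extD_sum {n : ℕ} {ι : Type*} (s : Finset ι) {α : ι → Euc n → Ext n}
    (hα : ∀ i, ContDiff ℝ ∞ (α i)) (a : Euc n) :
    extD (fun b => ∑ i ∈ s, α i b) a = ∑ i ∈ s, extD (α i) a := by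
  classical
  induction s using Finset.induction_on with
  | empty => simpa using extD_zero a
  | insert i s hi ih =>
    simp only [Finset.sum_insert hi]
    rw [extD_add (hα i) (ContDiff.sum fun i _ => hα i), ih]

/-- Expand `α` as a sum of `f_I dx_I`. Both `dx_I` and its pullback are closed, so only the
coefficients get differentiated, and the chain rule for functions remains. -/
theorem extD_pullAt {m n : ℕ} {g : Euc m → Euc n} (hg : ContDiff ℝ ∞ g) {α : Euc n → Ext n}
    (hα : ContDiff ℝ ∞ α) (a : Euc m) :
    extD (fun b => pullAt g b (α (g b))) a = pullAt g a (extD α (g a)) := by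
  let f : Finset (Fin n) → Euc n → ℝ := fun I y => (dxBasis n).repr (α y) I
  have hf : ∀ I, ContDiff ℝ ∞ (f I) := (contDiff_iff_coeff α).1 hα
  have hα' : α = fun y => ∑ I, algebraMap ℝ (Ext n) (f I y) * dxBasis n I := by
    funext y
    simp only [← Algebra.smul_def]
    exact ((dxBasis n).sum_repr (α y)).symm
  have h₁ : ∀ I, ContDiff ℝ ∞ fun b => algebraMap ℝ (Ext m) (f I (g b)) := fun I =>
    contDiff_algebraMap ((hf I).comp hg)
  have h₂ : ∀ I, ContDiff ℝ ∞ fun y => algebraMap ℝ (Ext n) (f I y) := fun I =>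
    contDiff_algebraMap (hf I)
  have h₃ : ∀ I, (fderiv ℝ (fun b => f I (g b)) a).toLinearMap =
      (fderiv ℝ g a).toLinearMap.dualMap (fderiv ℝ (f I) (g a)).toLinearMap := by
    intro I
    have h := (((hf I).differentiable (by simp)) (g a)).hasFDerivAt.comp a
      ((hg.differentiable (by simp)) a).hasFDerivAt
    ext x
    exact DFunLike.congr_fun h.fderiv x
  rw [hα']
  simp only [map_sum, map_mul, AlgHom.commutes]
  rw [extD_sum _ fun I => contDiff_ext_mul (h₁ I) (pullAt_const hg _).1,
    extD_sum _ fun I => contDiff_ext_mul (h₂ I) contDiff_const, map_sum]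
  refine Finset.sum_congr rfl fun I _ => ?_
  rw [extD_mul (h₁ I) (pullAt_const hg _).1, extD_mul (h₂ I) contDiff_const, extD_const,
    (pullAt_const hg _).2, extD_algebraMap (f := fun b => f I (g b)) ((hf I).comp hg),
    extD_algebraMap (hf I)]
  simp [h₃, ExteriorAlgebra.map_apply_ι]

/-! ## Operations on forms -/

section Spaces

variable {A B C : Type*} [NormedAddCommGroup A] [NormedSpace ℝ A]
  [NormedAddCommGroup B] [NormedSpace ℝ B] [NormedAddCommGroup C] [NormedSpace ℝ C]

theorem SmoothMap.toFun_injective {X : Set A} {Y : Set B} {f g : SmoothMap X Y}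
    (h : f.toFun = g.toFun) : f = g := by
  cases f; cases g; cases h; rfl

/-- Smooth maps carry an extension to the ambient space, but plots take values in `X`, so forms do
not see the choice of extension. -/
theorem pullback_congr {X : Set A} {Y : Set B} {f g : SmoothMap X Y}
    (h : ∀ x ∈ X, f.toFun x = g.toFun x) (α : PreForm Y) : pullback f α = pullback g α := by
  funext n p
  have : f.comp p = g.comp p :=
    SmoothMap.toFun_injective (funext fun a => h _ (p.mapsTo (Set.mem_univ a)))
  simp only [pullback, this]

theorem pullback_mul {X : Set A} {Y : Set B} (f : SmoothMap X Y) (α β : PreForm Y) :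
    pullback f (α * β) = pullback f α * pullback f β := rfl

theorem IsForm.contDiff {X : Set A} {α : PreForm X} (h : IsForm α) (n : ℕ) (p : Plot X n) :
    ContDiff ℝ ∞ (α n p) :=
  (contDiff_iff_coeff _).2 (h.smooth n p)

/-- The family `α` is a smooth differential form of degree `k`. -/
structure IsFormOfDegree {X : Set A} (k : ℕ) (α : PreForm X) : Prop where
  isForm : IsForm α
  degree : ∀ (n : ℕ) (p : Plot X n) (a : Euc n), α n p a ∈ ⋀[ℝ]^k (Module.Dual ℝ (Euc n))

namespace IsFormOfDegree

variable {X : Set A} {Y : Set B} {j k : ℕ} {α β : PreForm X}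

theorem _root_.TadpoleFree.Form.isFormOfDegree (F : Form X k) : IsFormOfDegree k F.val :=
  ⟨F.isForm, F.degree⟩

theorem zero : IsFormOfDegree k (0 : PreForm X) where
  isForm :=
    { smooth := fun _ _ => (contDiff_iff_coeff _).1 contDiff_const
      natural := fun _ _ _ _ _ => (map_zero _).symm }
  degree _ _ _ := Submodule.zero_mem _

theorem one : IsFormOfDegree 0 (1 : PreForm X) where
  isForm :=
    { smooth := fun _ _ => (contDiff_iff_coeff _).1 contDiff_const
      natural := fun _ _ _ _ _ => (map_one _).symm }
  degree _ _ _ := by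
    change _ ∈ LinearMap.range (ExteriorAlgebra.ι ℝ) ^ 0
    rw [pow_zero]
    exact Submodule.one_le.1 le_rfl

theorem mul (hα : IsFormOfDegree j α) (hβ : IsFormOfDegree k β) :
    IsFormOfDegree (j + k) (α * β) where
  isForm :=
    { smooth := fun n p => (contDiff_iff_coeff _).1
        (contDiff_ext_mul (hα.isForm.contDiff n p) (hβ.isForm.contDiff n p))
      natural := fun m n p g a => by
        simp only [Pi.mul_apply, map_mul, hα.isForm.natural, hβ.isForm.natural] }
  degree n p a := by
    change _ ∈ LinearMap.range (ExteriorAlgebra.ι ℝ) ^ (j + k)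
    rw [pow_add]
    exact Submodule.mul_mem_mul (hα.degree n p a) (hβ.degree n p a)

theorem pullback {α : PreForm Y} (hα : IsFormOfDegree k α) (f : SmoothMap X Y) :
    IsFormOfDegree k (pullback f α) where
  isForm :=
    { smooth := fun n p => hα.isForm.smooth n (f.comp p)
      natural := fun m n p g a => hα.isForm.natural m n (f.comp p) g a }
  degree n p a := hα.degree n (f.comp p) a

theorem deRham (hα : IsFormOfDegree k α) : IsFormOfDegree (k + 1) (deRham α) where
  isForm :=
    { smooth := fun n p => (contDiff_iff_coeff _).1 (contDiff_extD (hα.isForm.contDiff n p))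
      natural := fun m n p g a => by
        have h : α m (p.comp g) = fun b => pullAt g.toFun b (α n p (g.toFun b)) :=
          funext fun b => hα.isForm.natural m n p g b
        simp only [TadpoleFree.deRham, h]
        exact extD_pullAt g.contDiff (hα.isForm.contDiff n p) a }
  degree n p a := extD_mem (hα.isForm.contDiff n p) (hα.degree n p) a

theorem mul_comm (hα : IsFormOfDegree j α) (hβ : IsFormOfDegree k β) :
    α * β = (-1 : ℝ) ^ (j * k) • (β * α) := by
  funext n p a
  exact mul_comm_of_mem (hα.degree n p a) (hβ.degree n p a)

theorem deRham_mul (hα : IsFormOfDegree j α) (hβ : IsFormOfDegree k β) :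
    TadpoleFree.deRham (α * β) =
      TadpoleFree.deRham α * β + (-1 : ℝ) ^ j • (α * TadpoleFree.deRham β) := by
  funext n p a
  refine (extD_mul (hα.isForm.contDiff n p) (hβ.isForm.contDiff n p) a).trans ?_
  rw [involute_of_mem (hα.degree n p a), smul_mul_assoc]
  rfl

theorem deRham_deRham (hα : IsFormOfDegree k α) :
    TadpoleFree.deRham (TadpoleFree.deRham α) = 0 := by
  funext n p a
  exact extD_extD (hα.isForm.contDiff n p) a

end IsFormOfDegree

theorem deRham_zero {X : Set A} : deRham (0 : PreForm X) = 0 := by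
  funext n p a
  exact extD_zero a

theorem deRham_one {X : Set A} : deRham (1 : PreForm X) = 0 := by
  funext n p a
  exact extD_const 1 a

end Spaces

/-! ## Points of the compactified configuration space -/

section Worldsheet

theorem Worldsheet.forgetFun_forgetFun {V V' W : Type} {E : Type*} (f : W ↪ V) (g : V ↪ V') (c : Ambient V' E) :
    forgetFun f (forgetFun g c) = forgetFun (f.trans g) c := by
  have h : ((f.sumMap f).trans (g.sumMap g) : W ⊕ W ↪ V' ⊕ V') = (f.trans g).sumMap (f.trans g) := by
    ext i; rcases i with i | i <;> rfl
  refine Prod.ext rfl ?_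
  funext T i
  simp only [forgetFun, Finset.map_map, h]
  rw [← h]
  rfl

variable {E : Type*} [NormedAddCommGroup E] [InnerProductSpace ℝ E]

/-- The rescaling is singular only if its norm vanishes, which would put all points of `T` at their
barycentre; two distinct points prevent this. -/
theorem continuousAt_screen {ι Z : Type*} [DecidableEq ι] [TopologicalSpace Z] {T : Finset ι}
    {y : Z → ι → E} {z : Z} (hy : Continuous y) {i j : ι} (hi : i ∈ T) (hj : j ∈ T)
    (hij : y z i ≠ y z j) : ContinuousAt (fun z => screen T (y z)) z := by
  rw [continuousAt_pi]
  intro k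
  have hy' : ∀ k, Continuous fun z => y z k := fun k => (continuous_apply k).comp hy
  by_cases hk : k ∈ T
  · simp only [screen, hk, if_true]
    refine ContinuousAt.smul (ContinuousAt.inv₀ (by fun_prop) fun h => hij ?_) (by fun_prop)
    rw [Real.sqrt_eq_zero (Finset.sum_nonneg fun _ _ => sq_nonneg _),
      Finset.sum_eq_zero_iff_of_nonneg fun _ _ => sq_nonneg _] at h
    have h' : ∀ k ∈ T, y z k = (T.card : ℝ)⁻¹ • ∑ l ∈ T, y z l := fun k hk => by
      simpa [sub_eq_zero] using h k hk
    rw [h' i hi, h' j hj]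
  · simpa only [screen, hk, if_false] using continuousAt_const

namespace Worldsheet

variable (S : Worldsheet E) {V V' W : Type}

theorem continuous_doubled : Continuous (S.doubled : (V → E) → V ⊕ V → E) := by
  refine continuous_pi ?_
  rintro (v | v)
  · exact continuous_apply v
  · exact S.mirror.continuous.comp (continuous_apply v)

theorem screen_eq_zero [DecidableEq V] {c : Ambient V E} (hc : c ∈ S.conf V) {T : Finset (V ⊕ V)}
    (hT : ¬ Separates T) : c.2 T = 0 := by
  have hcl : IsClosed {c : Ambient V E | c.2 T = 0} :=
    isClosed_eq (by fun_prop) continuous_const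
  refine closure_minimal ?_ hcl hc
  rintro _ ⟨x, -, rfl⟩
  simp [withScreens, hT]

/-- The screen of a set of points that do not all collide is determined by their positions. -/
theorem screen_eq [DecidableEq V] {c : Ambient V E} (hc : c ∈ S.conf V) {T : Finset (V ⊕ V)}
    (hT : Separates T)
    {i j : V ⊕ V} (hi : i ∈ T) (hj : j ∈ T) (hij : S.doubled c.1 i ≠ S.doubled c.1 j) :
    c.2 T = screen T (S.doubled c.1) := by
  have hne := mem_closure_iff_nhdsWithin_neBot.1 hc
  have h₁ : Filter.Tendsto (fun c : Ambient V E => c.2 T)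
      (nhdsWithin c (S.withScreens '' S.openConf V)) (nhds (c.2 T)) :=
    (Continuous.continuousAt (by fun_prop)).mono_left nhdsWithin_le_nhds
  have h₂ : Filter.Tendsto (fun c : Ambient V E => screen T (S.doubled c.1))
      (nhdsWithin c (S.withScreens '' S.openConf V)) (nhds (screen T (S.doubled c.1))) :=
    (continuousAt_screen (S.continuous_doubled.comp continuous_fst) hi hj hij).mono_left
      nhdsWithin_le_nhds
  -- Both sides are limits along honest configurations tending to `c`, and there the recorded screen
  -- is the screen of the positions.
  refine tendsto_nhds_unique (h₁.congr' ?_) h₂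
  filter_upwards [self_mem_nhdsWithin]
  rintro _ ⟨x, -, rfl⟩
  simp [withScreens, hT]

/-- A point of `Σ` that meets a mirror point lies in `Σ ∩ τΣ`, where the mirror acts trivially; so
collisions in the double are already collisions in `Σ`. -/
theorem eq_of_doubled_eq {x : V → E} (hx : ∀ v, x v ∈ S.carrier) {i j : V ⊕ V}
    (h : S.doubled x i = S.doubled x j) : x (under i) = x (under j) := by
  have key : ∀ v w, x v = S.mirror (x w) → x v = x w := fun v w h =>
    h.trans (S.fixed_of_mem_inter _ (hx w) (h ▸ hx v))
  rcases i with v | v <;> rcases j with w | w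
  · exact h
  · exact key v w h
  · exact (key w v (Eq.symm h)).symm
  · exact S.mirror.injective h

theorem doubled_comp_sumMap (x : V → E) (f : W ↪ V) :
    S.doubled x ∘ f.sumMap f = S.doubled (x ∘ f) := by
  funext i; rcases i with i | i <;> rfl

theorem under_sumMap (f : W ↪ V) (i : W ⊕ W) : under (f.sumMap f i) = f (under i) := by
  rcases i with i | i <;> rfl

theorem fst_eq_of_mem_stratum [DecidableEq V] {K M : Finset V} {c : Ambient V E}
    (hc : c ∈ S.stratum K M)
    {v w : V} (h : v = w ∨ (v ∈ K ∧ w ∈ K)) : c.1 v = c.1 w := by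
  have hcl : IsClosed {c : Ambient V E | c.1 v = c.1 w} := isClosed_eq (by fun_prop) (by fun_prop)
  exact closure_minimal (fun c hc => (hc.2.1 v w).2 h) hcl hc

/-- On the stratum where the points of `K` collide, keeping at most one of them, the result does not
depend on which one is kept. -/
theorem forgetFun_eq_of_mem_stratum [Fintype V] [DecidableEq V] [Fintype W] [DecidableEq W]
    {K M : Finset V} {f g : W ↪ V}
    (hfg : ∀ w, f w = g w ∨ (f w ∈ K ∧ g w ∈ K))
    (hf : ∀ v w, f v ∈ K → f w ∈ K → v = w) (hg : ∀ v w, g v ∈ K → g w ∈ K → v = w)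
    {c : Ambient V E} (hc : c ∈ S.stratum K M) : forgetFun f c = forgetFun g c := by
  -- Equality of two continuous maps is a closed condition, so it may be checked on the open
  -- stratum, where only the points of `K` coincide.
  refine closure_minimal ?_ (isClosed_eq (contDiff_forgetFun f).continuous
    (contDiff_forgetFun g).continuous) hc
  rintro c ⟨hc, hK, -⟩
  have hpos : c.1 ∘ f = c.1 ∘ g := funext fun w => (hK _ _).2 (hfg w)
  -- A recorded screen involves two distinct labels. At most one of them lands in `K`, so their
  -- points differ and `screen_eq` applies.
  have key : ∀ f : W ↪ V, (∀ v w, f v ∈ K → f w ∈ K → v = w) → ∀ T : Finset (W ⊕ W),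
      Separates T → ∀ i, (forgetFun f c).2 T i = screen T (S.doubled (c.1 ∘ f)) i := by
    intro f hf T hT i
    obtain ⟨a, ha, b, hb, hab⟩ := hT
    have hne : S.doubled c.1 (f.sumMap f a) ≠ S.doubled c.1 (f.sumMap f b) := by
      intro h
      have h' := S.eq_of_doubled_eq (S.fst_mem c hc) h
      rw [under_sumMap, under_sumMap, hK] at h'
      exact hab (h'.elim (fun h => f.injective h) fun h => hf _ _ h.1 h.2)
    have := S.screen_eq hc ((separates_map f T).2 ⟨a, ha, b, hb, hab⟩)
      (Finset.mem_map_of_mem _ ha) (Finset.mem_map_of_mem _ hb) hne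
    rw [← S.doubled_comp_sumMap, ← screen_map, ← this]
    rfl
  refine Prod.ext hpos ?_
  funext T i
  by_cases hT : Separates T
  · rw [key f hf T hT, key g hg T hT, hpos]
  · have h : ∀ f : W ↪ V, (forgetFun f c).2 T i = 0 := fun f =>
      congrFun (S.screen_eq_zero hc (mt (separates_map f T).1 hT)) _
    rw [h, h]

theorem forget_comp_forget [Fintype V] [DecidableEq V] [Fintype V'] [DecidableEq V'] [Fintype W]
    [DecidableEq W] (f : W ↪ V) (g : V ↪ V') :
    (S.forget f).comp (S.forget g) = S.forget (f.trans g) :=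
  SmoothMap.toFun_injective (funext fun c => forgetFun_forgetFun f g c)

theorem mapsTo_forget_stratum [Fintype V] [DecidableEq V] (K M : Finset V) :
    Set.MapsTo (S.forget (.subtype (· ∈ K))).toFun (S.stratum K M)
      (S.stratum Finset.univ (M.subtype (· ∈ K))) := by
  refine Set.MapsTo.closure ?_ (S.forget _).contDiff.continuous
  rintro c ⟨hc, hK, hM⟩
  refine ⟨(S.forget _).mapsTo hc, fun v w => ?_, fun v => ?_⟩
  · exact (hK v w).trans (by simp)
  · exact (hM v).trans (by simp)

end Worldsheet

end Worldsheet

/-! ### Merging the vertices of `K` -/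

theorem represent_collapse {V : Type*} [DecidableEq V] {K : Finset V} {s : V} (hs : s ∈ K) (v : V) :
    v = represent K s hs (collapse K v) ∨ (v ∈ K ∧ represent K s hs (collapse K v) ∈ K) := by
  by_cases h : v ∈ K
  · rw [show collapse K v = none from dif_pos h]
    exact Or.inr ⟨h, hs⟩
  · rw [show collapse K v = some ⟨v, h⟩ from dif_neg h]
    exact Or.inl rfl

/-- The fibres of `collapse K` are the classes of the coincidence relation that defines the stratum.
-/
theorem collapse_eq_iff {V : Type*} [DecidableEq V] {K : Finset V} {v w : V} :
    collapse K v = collapse K w ↔ v = w ∨ (v ∈ K ∧ w ∈ K) := by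
  by_cases hv : v ∈ K <;> by_cases hw : w ∈ K <;> simp [collapse, hv, hw]
  · rintro rfl; exact hw hv
  · rintro rfl; exact hv hw

theorem eq_of_represent_mem {V : Type*} {K : Finset V} {s : V} (hs : s ∈ K)
    {v w : MergedVertices V K} (hv : represent K s hs v ∈ K) (hw : represent K s hs w ∈ K) :
    v = w := by
  have h : ∀ v : MergedVertices V K, represent K s hs v ∈ K → v = none := by
    rintro (_ | ⟨v, hv⟩) h
    · rfl
    · exact absurd h hv
  rw [h v hv, h w hw]

theorem pairEmb_trans {V V' : Type} {v w : V} (h : v ≠ w) (f : V ↪ V') (h' : f v ≠ f w) :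
    (pairEmb v w h).trans f = pairEmb (f v) (f w) h' := by
  ext i; fin_cases i <;> rfl

/-! ## Tadpoles under the operations on graphs -/

section Graphs

variable {V V' L : Type*}

namespace Part

theorem isLoop_relabel {f : V → V'} (hf : Function.Injective f) (e : Part V L) :
    (e.relabel f).IsLoop ↔ e.IsLoop := by
  cases e <;> simp [relabel, IsLoop, hf.eq_iff]

theorem isLoop_of_applyQ {e e' : Part V L} (h : e.applyQ = some e') : e'.IsLoop ↔ e.IsLoop := by
  cases e <;> simp only [applyQ, Option.some.injEq, reduceCtorEq] at h <;> subst h <;> rfl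

variable [DecidableEq V]

theorem isLoop_of_inside {K : Finset V} {e : Part V L} {e' : Part {v // v ∈ K} L}
    (h : e.inside K = some e') : e'.IsLoop ↔ e.IsLoop := by
  cases e <;> simp only [inside, Option.dite_none_right_eq_some, Option.some.injEq,
    reduceCtorEq] at h
  all_goals
    obtain ⟨_, rfl⟩ := h
    simp [IsLoop]

/-- The critical case: merging could close up an edge with two distinct ends in `K`, but such an
edge is inside `K`, which `h` excludes. -/
theorem isLoop_relabel_collapse {K : Finset V} {e : Part V L} (h : e.inside K = none) :
    (e.relabel (collapse K)).IsLoop ↔ e.IsLoop := by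
  cases e <;> simp only [inside, dite_eq_right_iff, reduceCtorEq, imp_false] at h <;>
    simp [relabel, IsLoop, collapse_eq_iff, h]

end Part

namespace FeynmanGraph

theorem hasTadpole_cons {e : Part V L} {Γ : FeynmanGraph V L} :
    HasTadpole (e :: Γ) ↔ e.IsLoop ∨ Γ.HasTadpole := by
  simp [HasTadpole]

theorem hasTadpole_append {Γ₁ Γ₂ : FeynmanGraph V L} :
    HasTadpole (Γ₁ ++ Γ₂) ↔ Γ₁.HasTadpole ∨ Γ₂.HasTadpole := by
  simp [HasTadpole, or_and_right, exists_or]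

theorem hasTadpole_swap {Γ₁ Γ₂ : FeynmanGraph V L} {e e' : Part V L} :
    HasTadpole (Γ₁ ++ e :: e' :: Γ₂) ↔ HasTadpole (Γ₁ ++ e' :: e :: Γ₂) := by
  simp only [hasTadpole_append, hasTadpole_cons]
  tauto

theorem hasTadpole_relabel {f : V → V'} (hf : Function.Injective f) {Γ : FeynmanGraph V L} :
    (Γ.relabel f).HasTadpole ↔ Γ.HasTadpole := by
  simp [HasTadpole, relabel, Part.isLoop_relabel hf]

theorem hasTadpole_disjointUnion {Γ₁ : FeynmanGraph V L} {Γ₂ : FeynmanGraph V' L} :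
    (Γ₁.disjointUnion Γ₂).HasTadpole ↔ Γ₁.HasTadpole ∨ Γ₂.HasTadpole := by
  rw [disjointUnion, hasTadpole_append, hasTadpole_relabel Sum.inl_injective,
    hasTadpole_relabel Sum.inr_injective]

theorem hasTadpole_of_mem_applyQ (deg : L → ℕ) {Γ Γ' : FeynmanGraph V L}
    (h : Γ' ∈ (Γ.applyQ deg).support) : Γ'.HasTadpole ↔ Γ.HasTadpole := by
  classical
  induction Γ generalizing Γ' with
  | nil => simp [applyQ] at h
  | cons e Γ ih =>
    rw [applyQ] at h
    -- Only an inclusion of supports is needed, so possible cancellations between the terms do no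
    -- harm.
    rcases Finset.mem_union.1 (Finsupp.support_add h) with h | h
    · rcases he : e.applyQ with _ | e' <;> rw [he] at h
      · simp at h
      · obtain rfl : Γ' = e' :: Γ := Finset.mem_singleton.1 (Finsupp.support_single_subset h)
        rw [hasTadpole_cons, hasTadpole_cons, Part.isLoop_of_applyQ he]
    · obtain ⟨Γ'', hΓ'', rfl⟩ :=
        Finset.mem_image.1 (Finsupp.mapDomain_support (Finsupp.support_smul h))
      rw [hasTadpole_cons, hasTadpole_cons, ih hΓ'']

variable [DecidableEq V]

theorem cut_cons_of_inside (deg : L → ℕ) {K : Finset V} {e : Part V L}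
    {e' : Part {v // v ∈ K} L} (h : e.inside K = some e') (Γ : FeynmanGraph V L) :
    cut deg K (e :: Γ) = ((cut deg K Γ).1, e' :: (cut deg K Γ).2.1, (cut deg K Γ).2.2) := by
  simp [cut, h]

theorem cut_cons_of_not_inside (deg : L → ℕ) {K : Finset V} {e : Part V L}
    (h : e.inside K = none) (Γ : FeynmanGraph V L) :
    cut deg K (e :: Γ) =
      ((-1) ^ (e.degree deg * degree deg (cut deg K Γ).2.1) * (cut deg K Γ).1,
        (cut deg K Γ).2.1, e.relabel (collapse K) :: (cut deg K Γ).2.2) := by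
  simp [cut, h]

theorem hasTadpole_cut (deg : L → ℕ) (K : Finset V) (Γ : FeynmanGraph V L) :
    Γ.HasTadpole ↔ (Γ.cut deg K).2.1.HasTadpole ∨ (Γ.cut deg K).2.2.HasTadpole := by
  induction Γ with
  | nil => simp [cut, HasTadpole]
  | cons e Γ ih =>
    rcases h : e.inside K with _ | e'
    · rw [cut_cons_of_not_inside deg h, hasTadpole_cons, hasTadpole_cons,
        Part.isLoop_relabel_collapse h, ih]
      tauto
    · rw [cut_cons_of_inside deg h, hasTadpole_cons, hasTadpole_cons, Part.isLoop_of_inside h, ih]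
      tauto

end FeynmanGraph

end Graphs

/-! ## Amplitudes -/

namespace FeynmanData

variable {E : Type*} [NormedAddCommGroup E] [InnerProductSpace ℝ E]
  {S : Worldsheet E} {L : Type*} (D : FeynmanData S L)
  {V V' : Type} [Fintype V] [DecidableEq V] [Fintype V'] [DecidableEq V']

theorem partForm_isFormOfDegree (e : Part V L) :
    IsFormOfDegree (e.degree D.deg) (D.partForm e) := by
  cases e with
  | propagator v w =>
    by_cases h : v = w
    · simpa [partForm, h] using IsFormOfDegree.zero
    · simp only [partForm, ne_eq, h, not_false_eq_true, dite_true]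
      exact D.P.isFormOfDegree.pullback _
  | diagonal v w => exact D.Ξ.isFormOfDegree.pullback _
  | leg v ℓ => exact (D.φ ℓ).isFormOfDegree.pullback _
  | dleg v ℓ => exact (D.φ ℓ).isFormOfDegree.deRham.pullback _

theorem prod_isFormOfDegree (Γ : FeynmanGraph V L) :
    IsFormOfDegree (Γ.degree D.deg) (Γ.map D.partForm).prod := by
  induction Γ with
  | nil => exact IsFormOfDegree.one
  | cons e Γ ih =>
    rw [List.map_cons, List.prod_cons]
    exact (D.partForm_isFormOfDegree e).mul ih

variable {D} in
theorem amplitude_of_hasTadpole {Γ : FeynmanGraph V L} (h : Γ.HasTadpole) : D.amplitude Γ = 0 :=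
  if_pos h

variable {D} in
theorem amplitude_of_not_hasTadpole {Γ : FeynmanGraph V L} (h : ¬ Γ.HasTadpole) :
    D.amplitude Γ = (Γ.map D.partForm).prod :=
  if_neg h

theorem amplitude_isFormOfDegree (Γ : FeynmanGraph V L) :
    IsFormOfDegree (Γ.degree D.deg) (D.amplitude Γ) := by
  by_cases h : Γ.HasTadpole
  · rw [amplitude_of_hasTadpole h]
    exact IsFormOfDegree.zero
  · rw [amplitude_of_not_hasTadpole h]
    exact D.prod_isFormOfDegree Γ

/-- Graphs with tadpoles form an ideal whose complement is closed under products, so extension by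
zero keeps the amplitude multiplicative. -/
theorem amplitude_append (Γ₁ Γ₂ : FeynmanGraph V L) :
    D.amplitude (Γ₁ ++ Γ₂) = D.amplitude Γ₁ * D.amplitude Γ₂ := by
  by_cases h₁ : Γ₁.HasTadpole
  · rw [amplitude_of_hasTadpole h₁, zero_mul,
      amplitude_of_hasTadpole (FeynmanGraph.hasTadpole_append.2 (Or.inl h₁))]
  by_cases h₂ : Γ₂.HasTadpole
  · rw [amplitude_of_hasTadpole h₂, mul_zero,
      amplitude_of_hasTadpole (FeynmanGraph.hasTadpole_append.2 (Or.inr h₂))]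
  rw [amplitude_of_not_hasTadpole h₁, amplitude_of_not_hasTadpole h₂,
    amplitude_of_not_hasTadpole (by simp [FeynmanGraph.hasTadpole_append, h₁, h₂]),
    List.map_append, List.prod_append]

theorem amplitude_cons (e : Part V L) (Γ : FeynmanGraph V L) :
    D.amplitude (e :: Γ) = D.amplitude [e] * D.amplitude Γ :=
  D.amplitude_append [e] Γ

theorem amplitude_swap (Γ₁ Γ₂ : FeynmanGraph V L) (e e' : Part V L) :
    D.amplitude (Γ₁ ++ e :: e' :: Γ₂) =
      (-1 : ℝ) ^ (e.degree D.deg * e'.degree D.deg) • D.amplitude (Γ₁ ++ e' :: e :: Γ₂) := by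
  have h := (D.amplitude_isFormOfDegree [e]).mul_comm (D.amplitude_isFormOfDegree [e'])
  simp only [FeynmanGraph.degree, List.map_cons, List.map_nil, List.sum_cons, List.sum_nil,
    add_zero] at h
  rw [amplitude_append, amplitude_append, D.amplitude_cons e (e' :: Γ₂),
    D.amplitude_cons e' Γ₂, D.amplitude_cons e' (e :: Γ₂), D.amplitude_cons e Γ₂,
    ← mul_assoc (D.amplitude [e]), h, smul_mul_assoc, mul_smul_comm, mul_assoc (D.amplitude [e'])]

theorem partForm_relabel (f : V ↪ V') (e : Part V L) :
    D.partForm (e.relabel f) = pullback (S.forget f) (D.partForm e) := by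
  cases e with
  | propagator v w =>
    by_cases h : v = w
    · simp only [Part.relabel, partForm, h, ne_eq, not_true_eq_false, dite_false]
      rfl
    · have h' : f v ≠ f w := fun h' => h (f.injective h')
      simp only [Part.relabel, partForm, ne_eq, h, h', not_false_eq_true, dite_true]
      rw [← pairEmb_trans h f h', ← S.forget_comp_forget]
      rfl
  | diagonal v w => rfl
  | leg v ℓ => rfl
  | dleg v ℓ => rfl

theorem amplitude_relabel (f : V ↪ V') (Γ : FeynmanGraph V L) :
    D.amplitude (Γ.relabel f) = pullback (S.forget f) (D.amplitude Γ) := by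
  by_cases h : Γ.HasTadpole
  · rw [amplitude_of_hasTadpole h,
      amplitude_of_hasTadpole ((FeynmanGraph.hasTadpole_relabel f.injective).2 h)]
    rfl
  · rw [amplitude_of_not_hasTadpole h,
      amplitude_of_not_hasTadpole (mt (FeynmanGraph.hasTadpole_relabel f.injective).1 h)]
    clear h
    induction Γ with
    | nil => rfl
    | cons e Γ ih =>
      simp only [FeynmanGraph.relabel, List.map_cons, List.prod_cons, partForm_relabel] at ih ⊢
      rw [ih]
      rfl

theorem amplitude_disjointUnion (Γ₁ : FeynmanGraph V L) (Γ₂ : FeynmanGraph V' L) :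
    D.amplitude (Γ₁.disjointUnion Γ₂) =
      pullback (S.forget Function.Embedding.inl) (D.amplitude Γ₁) *
        pullback (S.forget Function.Embedding.inr) (D.amplitude Γ₂) := by
  rw [FeynmanGraph.disjointUnion, amplitude_append]
  exact congrArg₂ _ (D.amplitude_relabel Function.Embedding.inl Γ₁)
    (D.amplitude_relabel Function.Embedding.inr Γ₂)

/-! ### The differential -/

/-- For distinct vertices the map to `Σ × Σ` factors through the two-point configuration space,
where `deRham_P` applies. -/
theorem partForm_diagonal {v w : V} (h : v ≠ w) : D.partForm (.diagonal v w) =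
    deRham (D.partForm (.propagator v w)) := by
  have h' : deRham (D.partForm (.propagator v w)) =
      pullback (S.forget (pairEmb v w h)) (deRham D.P.val) := by
    simp only [partForm, ne_eq, h, not_false_eq_true, dite_true]
    rfl
  rw [h', D.deRham_P]
  rfl

/-- `Ξ` is not assumed closed on `Σ × Σ`. Its pullback along two distinct vertices is exact, and
therefore closed; this fails to apply to loops. -/
theorem deRham_partForm {e : Part V L} (he : ¬ e.IsLoop) :
    deRham (D.partForm e) = (e.applyQ.map D.partForm).getD 0 := by
  cases e with
  | propagator v w => exact (D.partForm_diagonal he).symm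
  | diagonal v w =>
    rw [D.partForm_diagonal he]
    exact (D.partForm_isFormOfDegree _).deRham_deRham
  | leg v ℓ => rfl
  | dleg v ℓ => exact ((D.φ ℓ).isFormOfDegree.pullback (S.position v)).deRham_deRham

theorem amplitudeSum_eq_linearCombination (x : GraphSpace V L) :
    D.amplitudeSum x = Finsupp.linearCombination ℝ D.amplitude x := rfl

theorem amplitudeSum_mapDomain_cons (e : Part V L) (x : GraphSpace V L) :
    D.amplitudeSum (x.mapDomain (e :: ·)) = D.amplitude [e] * D.amplitudeSum x := by
  rw [amplitudeSum_eq_linearCombination, amplitudeSum_eq_linearCombination,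
    Finsupp.linearCombination_mapDomain, ← LinearMap.mulLeft_apply (R := ℝ),
    Finsupp.apply_linearCombination]
  congr 2
  exact funext fun Γ => D.amplitude_cons e Γ

theorem deRham_amplitude (Γ : FeynmanGraph V L) :
    deRham (D.amplitude Γ) = D.amplitudeSum (Γ.applyQ D.deg) := by
  by_cases h : Γ.HasTadpole
  · rw [amplitude_of_hasTadpole h, deRham_zero]
    -- Every graph in the support of `QΓ` inherits a tadpole, so the right side vanishes term by
    -- term.
    refine (Finset.sum_eq_zero fun Γ' hΓ' => ?_).symm
    simp only [amplitude_of_hasTadpole ((FeynmanGraph.hasTadpole_of_mem_applyQ D.deg hΓ').2 h),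
      smul_zero]
  induction Γ with
  | nil =>
    rw [amplitude_of_not_hasTadpole h, List.map_nil, List.prod_nil, deRham_one]
    exact Finsupp.sum_zero_index.symm
  | cons e Γ ih =>
    rw [FeynmanGraph.hasTadpole_cons, not_or] at h
    have he : D.amplitude [e] = D.partForm e := by
      rw [amplitude_of_not_hasTadpole (by simp [FeynmanGraph.HasTadpole, h.1]), List.map_singleton,
        List.prod_singleton]
    rw [amplitude_cons, he,
      (D.partForm_isFormOfDegree e).deRham_mul (D.amplitude_isFormOfDegree Γ), ih h.2,
      FeynmanGraph.applyQ, amplitudeSum_eq_linearCombination _ (_ + _), map_add, map_smul,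
      ← amplitudeSum_eq_linearCombination, ← amplitudeSum_eq_linearCombination,
      amplitudeSum_mapDomain_cons, he, D.deRham_partForm h.1]
    -- The Leibniz rule mirrors the recursion of `applyQ`: the terms where `Q` acts on the tail
    -- agree, and the action on the head remains.
    congr 1
    rcases hQ : e.applyQ with _ | e'
    · simp [amplitudeSum_eq_linearCombination]
    · have he' : D.amplitude [e'] = D.partForm e' := by
        rw [amplitude_of_not_hasTadpole
          (by simp [FeynmanGraph.HasTadpole, Part.isLoop_of_applyQ hQ, h.1]), List.map_singleton,
          List.prod_singleton]
      simp only [amplitudeSum_eq_linearCombination, Finsupp.linearCombination_single, one_smul,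
        Option.map_some, Option.getD_some]
      rw [D.amplitude_cons e' Γ, he']

/-! ### The restriction to the strata -/

theorem pullback_partForm_inside {K : Finset V} (M : Finset V) {e : Part V L}
    {e' : Part {v // v ∈ K} L} (h : e.inside K = some e') :
    pullback (S.stratumIncl K M) (D.partForm e) =
      pullback ((S.forget (.subtype (· ∈ K))).comp (S.stratumIncl K M)) (D.partForm e') := by
  have he : e = e'.relabel (Function.Embedding.subtype (· ∈ K)) := by
    cases e <;> simp only [Part.inside, Option.dite_none_right_eq_some, Option.some.injEq,
      reduceCtorEq] at h
    all_goals
      obtain ⟨_, rfl⟩ := h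
      rfl
  rw [he, partForm_relabel]
  rfl

/-- Legs and `Ξ` depend only on positions, which agree on the stratum. A propagator also sees
screens, and for it the pair must not lie wholly in `K`. -/
theorem pullback_partForm_collapse {K M : Finset V} {s : V} (hs : s ∈ K) {e : Part V L}
    (h : e.inside K = none) :
    pullback (S.stratumIncl K M) (D.partForm e) =
      pullback ((S.forget (represent K s hs)).comp (S.stratumIncl K M))
        (D.partForm (e.relabel (collapse K))) := by
  have key : ∀ c ∈ S.stratum K M, ∀ v, c.1 v = c.1 (represent K s hs (collapse K v)) :=
    fun c hc v => S.fst_eq_of_mem_stratum hc (represent_collapse hs v)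
  cases e with
  | propagator v w =>
    by_cases hvw : v = w
    -- A loop stays a loop under `collapse K`, and the default value gives `0` on both sides.
    · simp only [Part.relabel, partForm, hvw, ne_eq, not_true_eq_false, dite_false]
      rfl
    have hK : ¬ (v ∈ K ∧ w ∈ K) := by simpa [Part.inside] using h
    have hc : collapse K v ≠ collapse K w := by simp [collapse_eq_iff, hvw, hK]
    simp only [Part.relabel, partForm, ne_eq, hvw, hc, not_false_eq_true, dite_true]
    refine pullback_congr (f := (S.forget (pairEmb v w hvw)).comp (S.stratumIncl K M))
      (g := (S.forget (pairEmb _ _ hc)).comp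
        ((S.forget (represent K s hs)).comp (S.stratumIncl K M))) (fun c hcS => ?_) _
    change Worldsheet.forgetFun _ c = Worldsheet.forgetFun _ (Worldsheet.forgetFun _ c)
    rw [Worldsheet.forgetFun_forgetFun]
    refine S.forgetFun_eq_of_mem_stratum (fun i => ?_) (fun i j hi hj => ?_)
      (fun i j hi hj => ?_) hcS
    · fin_cases i
      · exact represent_collapse hs v
      · exact represent_collapse hs w
    · fin_cases i <;> fin_cases j
      · rfl
      · exact absurd ⟨hi, hj⟩ hK
      · exact absurd ⟨hj, hi⟩ hK
      · rfl
    · exact (pairEmb _ _ hc).injective (eq_of_represent_mem hs hi hj)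
  | diagonal v w =>
    exact pullback_congr (f := (S.positions v w).comp (S.stratumIncl K M))
      (g := (S.positions _ _).comp ((S.forget (represent K s hs)).comp (S.stratumIncl K M)))
      (fun c hc => Prod.ext (key c hc v) (key c hc w)) _
  | leg v ℓ =>
    exact pullback_congr (f := (S.position v).comp (S.stratumIncl K M))
      (g := (S.position _).comp ((S.forget (represent K s hs)).comp (S.stratumIncl K M)))
      (fun c hc => key c hc v) (D.φ ℓ).val
  | dleg v ℓ =>
    exact pullback_congr (f := (S.position v).comp (S.stratumIncl K M))
      (g := (S.position _).comp ((S.forget (represent K s hs)).comp (S.stratumIncl K M)))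
      (fun c hc => key c hc v) (deRham (D.φ ℓ).val)

/-- Induction on the list: an edge inside `K` joins the left factor directly, while any other part
must first pass the whole left factor, which produces the sign recorded by `cut`. -/
theorem pullback_prod_stratum {K M : Finset V} {s : V} (hs : s ∈ K) (Γ : FeynmanGraph V L) :
    pullback (S.stratumIncl K M) (Γ.map D.partForm).prod =
      (Γ.cut D.deg K).1 •
        (pullback ((S.forget (.subtype (· ∈ K))).comp (S.stratumIncl K M))
            ((Γ.cut D.deg K).2.1.map D.partForm).prod *
          pullback ((S.forget (represent K s hs)).comp (S.stratumIncl K M))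
            ((Γ.cut D.deg K).2.2.map D.partForm).prod) := by
  induction Γ with
  | nil => exact ((one_smul ℝ _).trans (mul_one _)).symm
  | cons e Γ ih =>
    rw [List.map_cons, List.prod_cons, pullback_mul, ih, mul_smul_comm, ← mul_assoc]
    rcases h : e.inside K with _ | e'
    · have hcomm := ((D.partForm_isFormOfDegree e).pullback (S.stratumIncl K M)).mul_comm
        ((D.prod_isFormOfDegree (FeynmanGraph.cut D.deg K Γ).2.1).pullback
          ((S.forget (.subtype (· ∈ K))).comp (S.stratumIncl K M)))
      rw [FeynmanGraph.cut_cons_of_not_inside D.deg h, hcomm, D.pullback_partForm_collapse hs h,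
        smul_mul_assoc, smul_smul, mul_assoc, mul_comm (FeynmanGraph.cut D.deg K Γ).1,
        List.map_cons, List.prod_cons, pullback_mul]
    · rw [FeynmanGraph.cut_cons_of_inside D.deg h, D.pullback_partForm_inside M h, List.map_cons,
        List.prod_cons, pullback_mul]

theorem pullback_amplitude_stratum {K M : Finset V} {s : V} (hs : s ∈ K) (Γ : FeynmanGraph V L) :
    pullback (S.stratumIncl K M) (D.amplitude Γ) =
      (Γ.cut D.deg K).1 •
        (pullback ((S.forget (.subtype (· ∈ K))).comp (S.stratumIncl K M))
            (D.amplitude (Γ.cut D.deg K).2.1) *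
          pullback ((S.forget (represent K s hs)).comp (S.stratumIncl K M))
            (D.amplitude (Γ.cut D.deg K).2.2)) := by
  have h := FeynmanGraph.hasTadpole_cut D.deg K Γ
  by_cases h₁ : (Γ.cut D.deg K).2.1.HasTadpole
  · rw [amplitude_of_hasTadpole h₁, amplitude_of_hasTadpole (h.2 (Or.inl h₁))]
    exact ((congrArg _ (zero_mul _)).trans (smul_zero _)).symm
  by_cases h₂ : (Γ.cut D.deg K).2.2.HasTadpole
  · rw [amplitude_of_hasTadpole h₂, amplitude_of_hasTadpole (h.2 (Or.inr h₂))]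
    exact ((congrArg _ (mul_zero _)).trans (smul_zero _)).symm
  rw [amplitude_of_not_hasTadpole h₁, amplitude_of_not_hasTadpole h₂,
    amplitude_of_not_hasTadpole (mt h.1 (not_or.2 ⟨h₁, h₂⟩))]
  exact D.pullback_prod_stratum hs Γ

end FeynmanData

end TadpoleFree

open TadpoleFree in
theorem mainTheorem10 {E : Type*} [NormedAddCommGroup E] [InnerProductSpace ℝ E]
    [FiniteDimensional ℝ E] (S : Worldsheet E) {L : Type*} (D : FeynmanData S L)
    (V V' : Type) [Fintype V] [DecidableEq V] [Fintype V'] [DecidableEq V'] :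
    -- the Feynman rules, extended by zero, define smooth differential forms
    (∀ Γ : FeynmanGraph V L, ∃ F : Form (S.conf V) (Γ.degree D.deg), F.val = D.amplitude Γ) ∧
    -- multiplication: products of graphs on the same vertices
    (∀ Γ₁ Γ₂ : FeynmanGraph V L,
      (FeynmanGraph.HasTadpole (Γ₁ ++ Γ₂) ↔ Γ₁.HasTadpole ∨ Γ₂.HasTadpole) ∧
      D.amplitude (Γ₁ ++ Γ₂) = D.amplitude Γ₁ * D.amplitude Γ₂) ∧
    -- multiplication: products of graphs on different vertices
    (∀ (Γ₁ : FeynmanGraph V L) (Γ₂ : FeynmanGraph V' L),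
      ((Γ₁.disjointUnion Γ₂).HasTadpole ↔ Γ₁.HasTadpole ∨ Γ₂.HasTadpole) ∧
      D.amplitude (Γ₁.disjointUnion Γ₂) =
        pullback (S.forget Function.Embedding.inl) (D.amplitude Γ₁) *
          pullback (S.forget Function.Embedding.inr) (D.amplitude Γ₂)) ∧
    -- the order of the edges and legs matters only by the Koszul sign
    (∀ (Γ₁ Γ₂ : FeynmanGraph V L) (e e' : Part V L),
      (FeynmanGraph.HasTadpole (Γ₁ ++ e :: e' :: Γ₂) ↔ FeynmanGraph.HasTadpole (Γ₁ ++ e' :: e :: Γ₂)) ∧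
      D.amplitude (Γ₁ ++ e :: e' :: Γ₂) =
        (-1 : ℝ) ^ (e.degree D.deg * e'.degree D.deg) • D.amplitude (Γ₁ ++ e' :: e :: Γ₂)) ∧
    -- relabelling the points, and adding points that are not attached to the graph
    (∀ (f : V ↪ V') (Γ : FeynmanGraph V L),
      ((Γ.relabel f).HasTadpole ↔ Γ.HasTadpole) ∧
      D.amplitude (Γ.relabel f) = pullback (S.forget f) (D.amplitude Γ)) ∧
    -- the action of `Q`
    (∀ Γ : FeynmanGraph V L,
      (∀ Γ' ∈ (Γ.applyQ D.deg).support, FeynmanGraph.HasTadpole Γ' ↔ Γ.HasTadpole) ∧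
      deRham (D.amplitude Γ) = D.amplitudeSum (Γ.applyQ D.deg)) ∧
    -- the restriction to the boundary strata
    (∀ (K M : Finset V) (s : V) (hs : s ∈ K),
      (∀ s' (hs' : s' ∈ K), ∀ c ∈ S.stratum K M,
        (S.forget (represent K s hs)).toFun c = (S.forget (represent K s' hs')).toFun c) ∧
      Set.MapsTo (S.forget (.subtype (· ∈ K))).toFun (S.stratum K M)
        (S.stratum Finset.univ (M.subtype (· ∈ K))) ∧
      ∀ Γ : FeynmanGraph V L,
        (Γ.HasTadpole ↔ (Γ.cut D.deg K).2.1.HasTadpole ∨ (Γ.cut D.deg K).2.2.HasTadpole) ∧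
        pullback (S.stratumIncl K M) (D.amplitude Γ) =
          (Γ.cut D.deg K).1 •
            (pullback ((S.forget (.subtype (· ∈ K))).comp (S.stratumIncl K M))
                (D.amplitude (Γ.cut D.deg K).2.1) *
              pullback ((S.forget (represent K s hs)).comp (S.stratumIncl K M))
                (D.amplitude (Γ.cut D.deg K).2.2))) := by
  refine ⟨fun Γ => ⟨⟨_, (D.amplitude_isFormOfDegree Γ).isForm,
      (D.amplitude_isFormOfDegree Γ).degree⟩, rfl⟩,
    fun Γ₁ Γ₂ => ⟨FeynmanGraph.hasTadpole_append, D.amplitude_append Γ₁ Γ₂⟩,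
    fun Γ₁ Γ₂ => ⟨FeynmanGraph.hasTadpole_disjointUnion, D.amplitude_disjointUnion Γ₁ Γ₂⟩,
    fun Γ₁ Γ₂ e e' => ⟨FeynmanGraph.hasTadpole_swap, D.amplitude_swap Γ₁ Γ₂ e e'⟩,
    fun f Γ => ⟨FeynmanGraph.hasTadpole_relabel f.injective, D.amplitude_relabel f Γ⟩,
    fun Γ => ⟨fun _ => FeynmanGraph.hasTadpole_of_mem_applyQ D.deg, D.deRham_amplitude Γ⟩,
    fun K M s hs => ⟨fun s' hs' c hc => ?_, S.mapsTo_forget_stratum K M,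
      fun Γ => ⟨FeynmanGraph.hasTadpole_cut D.deg K Γ, D.pullback_amplitude_stratum hs Γ⟩⟩⟩
  -- The two representations differ only at the merged vertex, and both of its representatives lie
  -- in `K`.
  refine S.forgetFun_eq_of_mem_stratum (fun v => ?_) (fun _ _ => eq_of_represent_mem hs)
    (fun _ _ => eq_of_represent_mem hs') hc
  rcases v with _ | v
  · exact Or.inr ⟨hs, hs'⟩
  · exact Or.inl rfl
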